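/- **Setting.** Let $\mathcal X$ be a measurable space, $\mathcal Y$ a finite set of labels, $\Phi$ a set of binary features on $\mathcal X$, and $\mathcal H_\Phi\subseteq\mathcal Y^{\mathcal X}$ a hypothesis class with a subclass $\mathcal H_{\Phi'}\subseteq\mathcal H_\Phi$ for every $\Phi'\subseteq\Phi$. In each round of a *feature feedback protocol* an instance $x$ arrives, the learner announces a predicted label and an explanation (one of those that the protocol allows after the labeled examples seen so far), and the teacher reveals the label $y$ and some feature feedback (possibly none). The protocol specifies the possible ground truths, the target concept $c^*:\mathcal X\to\mathcal Y$ of each ground truth, and which feedback to a given instance, prediction and explanation is correct for a ground truth. In the *stochastic setting* the rounds are generated i.i.d.: each round independently draws the instance, the label, whether an exception occurs, and the teacher's responses to all possible predictions and explanations. The stream is *consistent with the protocol except for an exception rate of at most $\epsilon$* if an exception has probability at most $\epsilon$ and there is a ground truth such that, almost surely, in every round without an exception the label is $c^*(x)$ and all the responses are correct. Let $\mathcal D$ be the distribution of $(x,y)$ in one round, $\mathrm{err}(h,\mathcal D)=\mathbb P_{(X,Y)\sim\mathcal D}[h(X)\ne Y]$ and $\mathrm{err}(\mathcal H',\mathcal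 D)=\inf_{h\in\mathcal H'}\mathrm{err}(h,\mathcal D)$. The *mistake rate* on a stream of length $n$ is the fraction of the $n$ rounds in which the predicted label differs from $y$. **Feature Influence.** A *feature discovery protocol* is a (measurable) learner which may stop after finitely many rounds and then outputs a set $\hat\Phi\subseteq\Phi$. The setting has *$\alpha$-Feature Influence* with exception rate $\epsilon$, confidence $\delta$, mistake bound $b\in\mathbb N$ and capacity bound $d\in\mathbb N$ if there is a feature discovery protocol such that, on every i.i.d. stream that is consistent with the protocol except for an exception rate of at most $\epsilon$, * almost surely it makes at most $b$ mistakes before it stops; * except on an event of probability at most $\delta$, if it stops then $\mathrm{err}(\mathcal H_{\hat\Phi},\mathcal D)\le\epsilon+\alpha$; * almost surely, if it stops then $\mathcal H_{\hat\Phi}$ is finite and $\log_2|\mathcal H_{\hat\Phi}|\le d$. **Theorem.** There are universal constants $C>0$ and $k\in\mathbb N$ such that the following holds. Let $\epsilon\in[0,1]$, $\alpha\in(0,1]$, $\delta\in(0,1)$, $b,d\in\mathbb N$, suppose that a feature feedback setting has $\alpha$-Feature Influence with exception rate $\epsilon$, confidence $\delta$, mistake bound $b$ and capacity bound $d$, and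 put $$T=\frac b\alpha+\Bigl(\frac{\epsilon}{\alpha^3}+\frac1{\alpha^2}\Bigr)\bigl(d+\log(1/\delta)\bigr).$$ Then for every stream length $n\ge C\,T\,\log^k(2+T)$, that is, for all $n$ of at least $\tilde O(T)$, there is an algorithm (depending on the setting, the parameters and $n$, but not on the stream) whose mistake rate is at most $\epsilon+2\alpha$ with probability at least $1-3\delta$ on every i.i.d. stream of length $n$ that is consistent with the protocol except for an exception rate of at most $\epsilon$. The algorithm runs a feature discovery protocol that witnesses the Feature Influence (the same one for all $n$), then makes arbitrary predictions for a certain number $n_1$ of rounds, and from then on predicts with a hypothesis $\hat h\in\mathcal H_{\hat\Phi}$ that has the smallest empirical error over $\mathcal H_{\hat\Phi}$ on the $n_1$ labeled examples of these rounds (if $\mathcal H_{\hat\Phi}$ is finite and non-empty). -/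

import Mathlib

open MeasureTheory

universe uX uY uE uW uT uZ

/-- A feature feedback protocol. In every round an instance `x` arrives, the learner announces a
predicted label `ŷ` together with an explanation `e`, and the teacher reveals the label and some
feature feedback `w` (one value of `W` may stand for `no feedback`). `Θ` is the type of the possible
ground truths (representations), which are unknown to the learner. -/
structure FeedbackProtocol (X : Type uX) (Y : Type uY) (E : Type uE) (W : Type uW)
    (Θ : Type uT) where
  /-- the target concept of a ground truth -/
  concept : Θ → X → Y
  /-- the explanations which the learner may attach to the prediction `ŷ` for the instance `x`,
  after having observed `t` labeled examples -/
  allowed : (t : ℕ) → (Fin t → X × Y) → X → Y → Set E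
  allowed_nonempty : ∀ t s x y, (allowed t s x y).Nonempty
  /-- `Correct θ x ŷ e w`: the feedback `w` to prediction `ŷ` and explanation `e` on the
  instance `x` is a correct one for the ground truth `θ` -/
  Correct : Θ → X → Y → E → W → Prop

/-- A class `H_Φ` of hypotheses over a set `Φ` of binary features: it has a subclass `H_F` for
every set `F` of features from `Φ`. -/
structure FeatureClass {X : Type uX} (Y : Type uY) (Φ : Set (X → Bool)) where
  cls : Set Φ → Set (X → Y)
  cls_subset : ∀ F : Set Φ, cls F ⊆ cls Set.univ

/-- What the learner gets to see in a round: the instance, its label, the feature feedback. -/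
abbrev Observation (X : Type uX) (Y : Type uY) (W : Type uW) := X × Y × W

/-- The first `t` terms of a sequence. -/
def pre {α : Type*} (t : ℕ) (o : ℕ → α) : Fin t → α := fun i => o i

/-- An interactive learner: from the past observations and the current instance it computes
a predicted label and an explanation. -/
structure Learner (X : Type uX) (Y : Type uY) (E : Type uE) (W : Type uW) where
  act : (t : ℕ) → (Fin t → Observation X Y W) → X → Y × E

/-- The learner only gives explanations that the protocol allows. -/
def Learner.Obeys {X : Type uX} {Y : Type uY} {E : Type uE} {W : Type uW} {Θ : Type uT}
    (A : Learner X Y E W) (p : FeedbackProtocol X Y E W Θ) : Prop :=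
  ∀ t o x, (A.act t o x).2 ∈ p.allowed t (fun i => ((o i).1, (o i).2.1)) x (A.act t o x).1

/-- The random part of one round of the stochastic setting: a random element `z` with law `P`
determines the instance, its label, whether an exception occurs, and how the teacher would respond
to every prediction and explanation. The rounds use independent copies of `z`. -/
structure Environment (Z : Type uZ) (X : Type uX) (Y : Type uY) (E : Type uE) (W : Type uW)
    [MeasurableSpace Z] [MeasurableSpace X] [MeasurableSpace Y] [MeasurableSpace E]
    [MeasurableSpace W] where
  P : Measure Z
  isProb : IsProbabilityMeasure P
  inst : Z → X
  label : Z → Y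
  exception : Set Z
  feedback : Z → Y → E → W
  measurable_inst : Measurable inst
  measurable_label : Measurable label
  measurableSet_exception : MeasurableSet exception
  measurable_feedback : Measurable fun q : Z × Y × E => feedback q.1 q.2.1 q.2.2

attribute [instance] Environment.isProb

namespace Environment

variable {Z : Type uZ} {X : Type uX} {Y : Type uY} {E : Type uE} {W : Type uW} {Θ : Type uT}
  [MeasurableSpace Z] [MeasurableSpace X] [MeasurableSpace Y] [MeasurableSpace E]
  [MeasurableSpace W]

/-- The environment conforms to the protocol, for some ground truth, except for a rate of at
most `ε` of exceptions. -/
def Consistent (env : Environment Z X Y E W) (p : FeedbackProtocol X Y E W Θ) (ε : ℝ) : Prop :=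
  env.P env.exception ≤ ENNReal.ofReal ε ∧
  ∃ θ : Θ, ∀ᵐ z ∂env.P, z ∉ env.exception →
    env.label z = p.concept θ (env.inst z) ∧
    ∀ (y : Y) (e : E), p.Correct θ (env.inst z) y e (env.feedback z y e)

/-- The distribution of labeled examples that is induced by the environment. -/
noncomputable def dist (env : Environment Z X Y E W) : Measure (X × Y) :=
  env.P.map fun z => (env.inst z, env.label z)

/-- The law of the i.i.d. stream. -/
noncomputable def streamLaw (env : Environment Z X Y E W) : Measure (ℕ → Z) :=
  Measure.infinitePi fun _ : ℕ => env.P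

/-- The sequence of observations of the learner `A` on the stream `ω`. -/
def transcript (env : Environment Z X Y E W) (A : Learner X Y E W) (ω : ℕ → Z) (t : ℕ) :
    Observation X Y W :=
  let a := A.act t (fun i : Fin t => transcript env A ω i) (env.inst (ω t))
  (env.inst (ω t), env.label (ω t), env.feedback (ω t) a.1 a.2)
termination_by t
decreasing_by exact i.isLt

/-- The label which `A` predicts in round `t` on the stream `ω`. -/
def prediction (env : Environment Z X Y E W) (A : Learner X Y E W) (ω : ℕ → Z) (t : ℕ) : Y :=
  (A.act t (pre t (env.transcript A ω)) (env.inst (ω t))).1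

open Classical in
/-- The number of mistakes of `A` in the first `n` rounds. -/
noncomputable def mistakes (env : Environment Z X Y E W) (A : Learner X Y E W) (ω : ℕ → Z)
    (n : ℕ) : ℕ :=
  ((Finset.range n).filter fun t => env.prediction A ω t ≠ env.label (ω t)).card

/-- The mistake rate of `A` on the first `n` rounds. -/
noncomputable def mistakeRate (env : Environment Z X Y E W) (A : Learner X Y E W) (ω : ℕ → Z)
    (n : ℕ) : ℝ :=
  (env.mistakes A ω n : ℝ) / n

end Environment

/-- The error of a hypothesis on a distribution. -/
noncomputable def err {X : Type uX} {Y : Type uY} [MeasurableSpace X] [MeasurableSpace Y]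
    (h : X → Y) (D : Measure (X × Y)) : ENNReal :=
  D {q | h q.1 ≠ q.2}

/-- The smallest error of a class of hypotheses; it is `⊤` for the empty class. -/
noncomputable def classErr {X : Type uX} {Y : Type uY} [MeasurableSpace X] [MeasurableSpace Y]
    (K : Set (X → Y)) (D : Measure (X × Y)) : ENNReal :=
  ⨅ h ∈ K, err h D

open Classical in
/-- The empirical error of a hypothesis on a finite sequence of labeled examples. -/
noncomputable def empErr {X : Type uX} {Y : Type uY} {m : ℕ} (h : X → Y) (S : Fin m → X × Y) : ℝ :=
  ((Finset.univ.filter fun i => h (S i).1 ≠ (S i).2).card : ℝ) / m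

/-- `h` is an empirical risk minimizer of the class `K` on the sample `S`. -/
def IsERM {X : Type uX} {Y : Type uY} {m : ℕ} (K : Set (X → Y)) (S : Fin m → X × Y)
    (h : X → Y) : Prop :=
  h ∈ K ∧ ∀ h' ∈ K, empErr h S ≤ empErr h' S

/-- A feature discovery protocol: a learner which, depending on the observations made so far,
either continues (`none`) or stops with a set of features. -/
structure DiscoveryProtocol {X : Type uX} (Y : Type uY) (E : Type uE) (W : Type uW)
    (Φ : Set (X → Bool)) extends Learner X Y E W where
  output : (t : ℕ) → (Fin t → Observation X Y W) → Option (Set Φ)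

namespace DiscoveryProtocol

variable {X : Type uX} {Y : Type uY} {E : Type uE} {W : Type uW} {Φ : Set (X → Bool)}

/-- On the observations `o`, the protocol has not stopped before observation number `t`. -/
def RunsUntil (π : DiscoveryProtocol Y E W Φ) (o : ℕ → Observation X Y W) (t : ℕ) : Prop :=
  ∀ s < t, π.output s (pre s o) = none

/-- On the observations `o`, the protocol stops after exactly `τ` observations with output `F`. -/
def StopsAt (π : DiscoveryProtocol Y E W Φ) (o : ℕ → Observation X Y W) (τ : ℕ) (F : Set Φ) :
    Prop :=
  π.RunsUntil o τ ∧ π.output τ (pre τ o) = some F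

/-- Measurability of a feature discovery protocol: its actions and its stopping rule are measurable,
and the (finite) classes which it returns can be listed measurably. The sets `S k` say which entries
of the list are in use. -/
structure IsMeasurable [MeasurableSpace X] [MeasurableSpace Y] [MeasurableSpace E]
    [MeasurableSpace W] (π : DiscoveryProtocol Y E W Φ) (H : FeatureClass Y Φ) : Prop where
  act : ∀ t, Measurable fun q : (Fin t → Observation X Y W) × X => π.act t q.1 q.2
  halts : ∀ t, MeasurableSet {o | π.output t o = none}
  cls : ∀ t, ∃ (g : ℕ → (Fin t → Observation X Y W) → X → Y)
      (S : ℕ → Set (Fin t → Observation X Y W)),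
    (∀ k, Measurable fun q : (Fin t → Observation X Y W) × X => g k q.1 q.2) ∧
    (∀ k, MeasurableSet (S k)) ∧
    ∀ o F, π.output t o = some F → (H.cls F).Finite → H.cls F = {h | ∃ k, o ∈ S k ∧ h = g k o}

end DiscoveryProtocol

/-- The feature discovery protocol `π` witnesses `α`-Feature Influence with exception rate `ε`,
confidence `δ`, mistake bound `b` and capacity bound `d`. -/
structure WitnessesFeatureInfluence.{z, x, y, e, w, s} {X : Type x} {Y : Type y} {E : Type e}
    {W : Type w} {Θ : Type s} [MeasurableSpace X] [MeasurableSpace Y] [MeasurableSpace E]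
    [MeasurableSpace W] (p : FeedbackProtocol X Y E W Θ) {Φ : Set (X → Bool)}
    (H : FeatureClass Y Φ) (α ε δ : ℝ) (b d : ℕ) (π : DiscoveryProtocol Y E W Φ) : Prop where
  obeys : π.toLearner.Obeys p
  measurable : π.IsMeasurable H
  /-- at no time before it stops has the protocol made more than `b` mistakes -/
  mistakes : ∀ (Z : Type z) [MeasurableSpace Z] (env : Environment Z X Y E W),
    env.Consistent p ε → ∀ᵐ ω ∂env.streamLaw, ∀ t,
      π.RunsUntil (env.transcript π.toLearner ω) t → env.mistakes π.toLearner ω t ≤ b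
  /-- the class given by the output has small error, up to an event of probability `δ` -/
  error : ∀ (Z : Type z) [MeasurableSpace Z] (env : Environment Z X Y E W),
    env.Consistent p ε →
      env.streamLaw {ω | ∃ τ F, π.StopsAt (env.transcript π.toLearner ω) τ F ∧
        ¬ classErr (H.cls F) env.dist ≤ ENNReal.ofReal (ε + α)} ≤ ENNReal.ofReal δ
  /-- the class given by the output is small, almost surely -/
  capacity : ∀ (Z : Type z) [MeasurableSpace Z] (env : Environment Z X Y E W),
    env.Consistent p ε → ∀ᵐ ω ∂env.streamLaw, ∀ τ F,
      π.StopsAt (env.transcript π.toLearner ω) τ F →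
        (H.cls F).Finite ∧ Real.logb 2 ((H.cls F).ncard : ℝ) ≤ d

/-- `α`-Feature Influence of a feature feedback setting. -/
def HasFeatureInfluence.{z, x, y, e, w, s} {X : Type x} {Y : Type y} {E : Type e}
    {W : Type w} {Θ : Type s} [MeasurableSpace X] [MeasurableSpace Y] [MeasurableSpace E]
    [MeasurableSpace W] (p : FeedbackProtocol X Y E W Θ) {Φ : Set (X → Bool)}
    (H : FeatureClass Y Φ) (α ε δ : ℝ) (b d : ℕ) : Prop :=
  ∃ π : DiscoveryProtocol Y E W Φ,
    WitnessesFeatureInfluence.{z, x, y, e, w, s} p H α ε δ b d π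

/-- The learner `A` first runs the feature discovery protocol `π`; in the `n₁` rounds after `π` has
stopped it may predict anything; from then on its predictions are those of a fixed hypothesis, which
is an empirical risk minimizer, on the `n₁` labeled examples of these rounds, of the class given by
the features that `π` has returned. -/
def Learner.DiscoversThenERM {X : Type uX} {Y : Type uY} {E : Type uE} {W : Type uW}
    {Φ : Set (X → Bool)} (A : Learner X Y E W) (π : DiscoveryProtocol Y E W Φ)
    (H : FeatureClass Y Φ) (n₁ : ℕ) : Prop :=
  ∀ o : ℕ → Observation X Y W,
    (∀ t, π.RunsUntil o (t + 1) → ∀ x, A.act t (pre t o) x = π.act t (pre t o) x) ∧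
    ∀ τ F, π.StopsAt o τ F → (H.cls F).Finite → (H.cls F).Nonempty →
      ∃ h : X → Y, IsERM (H.cls F)
          (fun i : Fin n₁ => ((o (τ + i)).1, (o (τ + i)).2.1)) h ∧
        ∀ t, τ + n₁ ≤ t → ∀ x, (A.act t (pre t o) x).1 = h x

/-- The expression inside the soft-O of the sample size. -/
noncomputable def sampleSize (α ε δ : ℝ) (b d : ℕ) : ℝ :=
  b / α + (ε / α ^ 3 + 1 / α ^ 2) * (d + Real.log (1 / δ))

/-! The learner runs the discovery protocol, ignores its performance on the next `n₁` rounds, and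
then follows an empirical risk minimizer of the returned class. Its mistakes number at most `b`
before stopping, at most `n₁` while sampling, and afterwards roughly the error of the chosen
hypothesis times `n`. With `b` and `n₁` at most `α n / 4` each and `(ε + 3/2 α) n` for the last
phase, the total is `(ε + 2α) n`. If the protocol has not stopped by round `n`, only the `b`
mistakes count.

The hypothesis is controlled by variance-sensitive Chernoff bounds: a deviation of order `α` around
a mean of order `ε + α` has probability `exp(-c m α² / (ε + α))` in `m` rounds. Hence `n₁` of order
`(ε + α) / α² * (d + log(1/δ))` suffices for a union bound over `2 ^ d` hypotheses, and `n₁ / α` has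
the form of the last term of `sampleSize`. No logarithmic factor is needed.

The class is random, and sampling begins at a random time. For a fixed time `t`, stopping at `t` and
the class depend only on the first `t` rounds, while the sample depends only on later ones;
`measure_le_mul_of_splice` makes this conditioning precise by resampling the future. The events of
stopping at different times are disjoint, so summing over `t` costs nothing
(`streamLaw_exists_stopsAt_badSample_le`). The pathwise mistake count is
`mistakes_le_of_not_badSample`. -/

open ProbabilityTheory

/-! ### Resampling the future of an i.i.d. stream, and Chernoff bounds. -/

section Streams

variable {Z : Type*}

/-- The sequence which agrees with `a` before time `t` and with `b` from time `t` on. -/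
def splice (t : ℕ) (a b : ℕ → Z) : ℕ → Z := fun i => if i < t then a i else b i

lemma splice_of_lt {t i : ℕ} (h : i < t) (a b : ℕ → Z) : splice t a b i = a i := if_pos h

lemma splice_of_le {t i : ℕ} (h : t ≤ i) (a b : ℕ → Z) : splice t a b i = b i :=
  if_neg (not_lt.2 h)

open Classical in
/-- The number of times in `I` at which the sequence `ω` is in `V`. -/
noncomputable def hitCount (V : Set Z) (ω : ℕ → Z) (I : Finset ℕ) : ℕ :=
  (I.filter fun i => ω i ∈ V).card

lemma hitCount_congr {V : Set Z} {ω ω' : ℕ → Z} {I : Finset ℕ} (h : ∀ i ∈ I, ω i = ω' i) :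
    hitCount V ω I = hitCount V ω' I := by
  classical
  unfold hitCount
  congr 1
  exact Finset.filter_congr fun i hi => by rw [h i hi]

lemma hitCount_eq_sum_indicator (V : Set Z) (ω : ℕ → Z) (I : Finset ℕ) :
    (hitCount V ω I : ℝ) = ∑ i ∈ I, V.indicator (1 : Z → ℝ) (ω i) := by
  classical
  simp [hitCount, Set.indicator_apply]

variable [MeasurableSpace Z] {P : Measure Z} [IsProbabilityMeasure P]

lemma measurable_splice (t : ℕ) :
    Measurable fun q : (ℕ → Z) × (ℕ → Z) => splice t q.1 q.2 := by
  refine measurable_pi_lambda _ fun i => ?_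
  by_cases h : i < t
  · simp only [splice, h, if_true]; fun_prop
  · simp only [splice, h, if_false]; fun_prop

/-- Replacing the terms of an i.i.d. sequence from time `t` on by those of an independent copy does
not change its law. -/
lemma measurePreserving_splice (P : Measure Z) [IsProbabilityMeasure P] (t : ℕ) :
    MeasurePreserving (fun q : (ℕ → Z) × (ℕ → Z) => splice t q.1 q.2)
      ((Measure.infinitePi fun _ : ℕ => P).prod (Measure.infinitePi fun _ : ℕ => P))
      (Measure.infinitePi fun _ : ℕ => P) := by
  classical
  refine ⟨measurable_splice t, Measure.eq_infinitePi _ fun s V hV => ?_⟩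
  rw [Measure.map_apply (measurable_splice t)
    (MeasurableSet.pi s.countable_toSet fun i _ => hV i)]
  -- A finite box pulls back to the product of its coordinates before `t` and those from `t` on.
  have : (fun q : (ℕ → Z) × (ℕ → Z) => splice t q.1 q.2) ⁻¹' (Set.pi (s : Set ℕ) V) =
      (Set.pi (s.filter (· < t) : Finset ℕ) V) ×ˢ
        (Set.pi (s.filter (¬ · < t) : Finset ℕ) V) := by
    ext q
    simp only [Set.mem_preimage, Set.mem_pi, Set.mem_prod, Finset.mem_coe, Finset.mem_filter]
    constructor
    · exact fun h => ⟨fun i hi => by simpa [splice, hi.2] using h i hi.1,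
        fun i hi => by simpa [splice, hi.2] using h i hi.1⟩
    · intro h i hi
      by_cases hit : i < t
      · simpa [splice, hit] using h.1 i ⟨hi, hit⟩
      · simpa [splice, hit] using h.2 i ⟨hi, hit⟩
  rw [this, Measure.prod_prod, Measure.infinitePi_pi _ (fun i _ => hV i),
    Measure.infinitePi_pi _ (fun i _ => hV i), Finset.prod_filter_mul_prod_filter_not]

/-- Transfers almost sure properties to prefixes: if `Q` depends on the first `t` terms only, one
good continuation already decides it. -/
lemma ae_of_ae_of_forall_splice {t : ℕ} {Q : (ℕ → Z) → Prop}
    (hQ : ∀ᵐ ω ∂(Measure.infinitePi fun _ : ℕ => P), Q ω) :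
    ∀ᵐ a ∂(Measure.infinitePi fun _ : ℕ => P), ∃ b, Q (splice t a b) := by
  have h := (measurePreserving_splice P t).quasiMeasurePreserving.ae hQ
  filter_upwards [Measure.ae_ae_of_ae_prod h] with a ha
  exact ha.exists

/-- If a property of the prefix of length `t` makes an event that also involves the later terms
unlikely, then the two together are unlikely. -/
lemma measure_le_mul_of_splice {t : ℕ} {B R : Set (ℕ → Z)} (hB : MeasurableSet B)
    (hR : MeasurableSet R) {c : ENNReal}
    (hsub : ∀ a b, splice t a b ∈ B → a ∈ R)
    (h : ∀ᵐ a ∂(Measure.infinitePi fun _ : ℕ => P), a ∈ R →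
      (Measure.infinitePi fun _ : ℕ => P) {b | splice t a b ∈ B} ≤ c) :
    (Measure.infinitePi fun _ : ℕ => P) B ≤ c * (Measure.infinitePi fun _ : ℕ => P) R := by
  -- By Fubini it suffices to bound the measure of the continuations of each prefix `a`: at most `c`
  -- on `R`, zero off `R`.
  rw [← (measurePreserving_splice P t).measure_preimage hB.nullMeasurableSet,
    Measure.prod_apply (measurable_splice t hB), ← lintegral_indicator_const hR]
  refine lintegral_mono_ae ?_
  filter_upwards [h] with a ha
  by_cases haR : a ∈ R
  · rw [Set.indicator_of_mem haR]
    exact ha haR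
  · rw [Set.indicator_of_notMem haR, nonpos_iff_eq_zero]
    convert measure_empty (μ := Measure.infinitePi fun _ : ℕ => P) using 2
    ext b
    simpa using fun hb => haR (hsub a b hb)

/-- The exact value is `1 + p (exp l - 1)` with `p = P.real V`. Bounding it by an exponential keeps
`p` in the exponent, which makes the tail bounds sensitive to the variance. -/
lemma mgf_indicator_le {V : Set Z} (hV : MeasurableSet V) (l : ℝ) :
    mgf (V.indicator (1 : Z → ℝ)) P l ≤ Real.exp (P.real V * (Real.exp l - 1)) := by
  have h : (fun z => Real.exp (l * V.indicator (1 : Z → ℝ) z)) =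
      fun z => 1 + V.indicator (fun _ => Real.exp l - 1) z := by
    ext z
    by_cases hz : z ∈ V <;> simp [hz]
  rw [mgf, h, integral_add (integrable_const _) ((integrable_const _).indicator hV),
    integral_indicator_const _ hV]
  simp only [integral_const, probReal_univ, smul_eq_mul, mul_one]
  linarith [Real.add_one_le_exp (P.real V * (Real.exp l - 1))]

lemma mgf_hitCount_le {V : Set Z} (hV : MeasurableSet V) (I : Finset ℕ) (l : ℝ) :
    mgf (fun ω => (hitCount V ω I : ℝ)) (Measure.infinitePi fun _ : ℕ => P) l ≤
      Real.exp (I.card * (P.real V * (Real.exp l - 1))) := by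
  have hm : Measurable (V.indicator (1 : Z → ℝ)) := measurable_one.indicator hV
  have hind := iIndepFun_infinitePi (P := fun _ : ℕ => P)
    (X := fun _ => V.indicator (1 : Z → ℝ)) fun _ => hm
  have heq : (fun ω : ℕ → Z => (hitCount V ω I : ℝ)) =
      ∑ i ∈ I, fun ω : ℕ → Z => V.indicator (1 : Z → ℝ) (ω i) := by
    ext ω
    simp [hitCount_eq_sum_indicator]
  rw [heq, hind.mgf_sum fun i => hm.comp (measurable_pi_apply i)]
  have hone : ∀ i : ℕ, mgf (fun ω : ℕ → Z => V.indicator (1 : Z → ℝ) (ω i))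
      (Measure.infinitePi fun _ : ℕ => P) l = mgf (V.indicator (1 : Z → ℝ)) P l := by
    intro i
    have h := mgf_map (μ := Measure.infinitePi fun _ : ℕ => P) (t := l)
      (X := V.indicator (1 : Z → ℝ)) (measurable_pi_apply i).aemeasurable (by fun_prop)
    rw [Measure.infinitePi_map_eval] at h
    exact h.symm
  rw [Finset.prod_congr rfl fun i _ => hone i, Finset.prod_const, Real.exp_nat_mul]
  exact pow_le_pow_left₀ mgf_nonneg (mgf_indicator_le hV l) _

lemma measurable_hitCount {V : Set Z} (hV : MeasurableSet V) (I : Finset ℕ) :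
    Measurable fun ω : ℕ → Z => (hitCount V ω I : ℝ) := by
  have hm : Measurable (V.indicator (1 : Z → ℝ)) := measurable_one.indicator hV
  simp_rw [hitCount_eq_sum_indicator]
  fun_prop

lemma integrable_exp_hitCount {V : Set Z} (hV : MeasurableSet V) (I : Finset ℕ) (l : ℝ) :
    Integrable (fun ω : ℕ → Z => Real.exp (l * hitCount V ω I))
      (Measure.infinitePi fun _ : ℕ => P) := by
  refine Integrable.of_bound (C := Real.exp (|l| * I.card))
    ((measurable_hitCount hV I).const_mul l).exp.aestronglyMeasurable (ae_of_all _ fun ω => ?_)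
  have h : (hitCount V ω I : ℝ) ≤ I.card := by
    classical
    exact_mod_cast Finset.card_filter_le _ _
  rw [Real.norm_eq_abs, Real.abs_exp]
  gcongr
  exact le_abs_self l

/-- Upper tail bound for the number of successes in independent trials. -/
lemma measureReal_le_hitCount_le {V : Set Z} (hV : MeasurableSet V) {I : Finset ℕ} {m q s : ℝ}
    (hI : I.card ≤ m) (hq : P.real V ≤ q) (hq0 : 0 < q) (hs : 0 ≤ s) (hsq : s ≤ 2 * q) :
    (Measure.infinitePi fun _ : ℕ => P).real {ω | (q + s) * m ≤ hitCount V ω I} ≤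
      Real.exp (-(m * (s ^ 2 / (4 * q)))) := by
  -- This `l` minimizes the exponent `-l s + q l²` left after `exp l - 1 ≤ l + l²`, which needs `l ≤
  -- 1`.
  set l := s / (2 * q) with hl
  have hl0 : 0 ≤ l := by positivity
  have hl1 : l ≤ 1 := by rw [hl, div_le_one (by positivity)]; exact hsq
  have hexp : Real.exp l - 1 ≤ l + l ^ 2 := by
    have := Real.abs_exp_sub_one_sub_id_le (x := l) (by rwa [abs_of_nonneg hl0])
    linarith [(abs_le.1 this).2]
  have hexp0 : 0 ≤ Real.exp l - 1 := by linarith [Real.add_one_le_exp l]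
  have hm : 0 ≤ m := le_trans (Nat.cast_nonneg _) hI
  refine (measure_ge_le_exp_mul_mgf _ hl0 (integrable_exp_hitCount hV I l)).trans ?_
  refine (mul_le_mul_of_nonneg_left (mgf_hitCount_le hV I l) (Real.exp_nonneg _)).trans ?_
  rw [← Real.exp_add, Real.exp_le_exp]
  have h1 : I.card * (P.real V * (Real.exp l - 1)) ≤ m * (q * (l + l ^ 2)) := by gcongr
  have h2 : -l * ((q + s) * m) + m * (q * (l + l ^ 2)) = -(m * (s ^ 2 / (4 * q))) := by
    rw [hl]; field_simp; ring
  linarith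

/-- Lower tail bound for the number of successes in independent trials. -/
lemma measureReal_hitCount_le_le {V : Set Z} (hV : MeasurableSet V) {I : Finset ℕ} {q s : ℝ}
    (hq : q ≤ P.real V) (hq0 : 0 < q) (hs : 0 ≤ s) (hsq : s ≤ q) :
    (Measure.infinitePi fun _ : ℕ => P).real {ω | hitCount V ω I ≤ (q - s) * I.card} ≤
      Real.exp (-(I.card * (s ^ 2 / (4 * q)))) := by
  set l := s / (2 * q) with hl
  have hl0 : 0 ≤ l := by positivity
  have hl1 : l ≤ 1 := by rw [hl, div_le_one (by positivity)]; linarith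
  have hexp : Real.exp (-l) - 1 ≤ -l + l ^ 2 := by
    have := Real.abs_exp_sub_one_sub_id_le (x := -l) (by rwa [abs_neg, abs_of_nonneg hl0])
    have := (abs_le.1 this).2
    linarith
  -- The sign lets the lower bound `q` replace `P.real V`.
  have hneg : -l + l ^ 2 ≤ 0 := by nlinarith
  refine (measure_le_le_exp_mul_mgf _ (neg_nonpos.2 hl0) (integrable_exp_hitCount hV I _)).trans ?_
  refine (mul_le_mul_of_nonneg_left (mgf_hitCount_le hV I _) (Real.exp_nonneg _)).trans ?_
  rw [← Real.exp_add, Real.exp_le_exp]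
  have h1 : I.card * (P.real V * (Real.exp (-l) - 1)) ≤ I.card * (q * (-l + l ^ 2)) := by
    gcongr ?_ * ?_
    exact (mul_le_mul_of_nonneg_left hexp measureReal_nonneg).trans
      (mul_le_mul_of_nonpos_right hq hneg)
  have h2 : -(-l) * ((q - s) * I.card) + I.card * (q * (-l + l ^ 2)) =
      -(I.card * (s ^ 2 / (4 * q))) := by
    rw [hl]; field_simp; ring
  linarith

end Streams

/-! ### Transcripts, and the probability of a bad sample. -/

namespace Environment

variable {Z : Type uZ} {X : Type uX} {Y : Type uY} {E : Type uE} {W : Type uW}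
  [MeasurableSpace Z] [MeasurableSpace X] [MeasurableSpace Y] [MeasurableSpace E]
  [MeasurableSpace W]

lemma transcript_eq (env : Environment Z X Y E W) (A : Learner X Y E W) (ω : ℕ → Z) (t : ℕ) :
    env.transcript A ω t = (env.inst (ω t), env.label (ω t), env.feedback (ω t)
      (A.act t (pre t (env.transcript A ω)) (env.inst (ω t))).1
      (A.act t (pre t (env.transcript A ω)) (env.inst (ω t))).2) := by
  rw [transcript]
  rfl

lemma pre_transcript_congr (env : Environment Z X Y E W) (A : Learner X Y E W) {ω ω' : ℕ → Z}
    (t : ℕ) (h : ∀ i < t, ω i = ω' i) :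
    pre t (env.transcript A ω) = pre t (env.transcript A ω') := by
  induction t with
  | zero => exact funext fun i => i.elim0
  | succ t ih =>
    have ih' := ih fun i hi => h i (hi.trans t.lt_succ_self)
    ext i : 1
    rcases Nat.lt_succ_iff_lt_or_eq.1 i.2 with hi | hi
    · exact congrFun ih' ⟨i, hi⟩
    · simp only [pre, hi]
      rw [transcript_eq, transcript_eq, ih', h t t.lt_succ_self]

lemma pre_transcript_splice (env : Environment Z X Y E W) (A : Learner X Y E W) {s t : ℕ}
    (hst : s ≤ t) (a b : ℕ → Z) :
    pre s (env.transcript A (splice t a b)) = pre s (env.transcript A a) :=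
  env.pre_transcript_congr A s fun _ hi => splice_of_lt (hi.trans_le hst) a b

lemma measurable_transcript (env : Environment Z X Y E W) (A : Learner X Y E W)
    (hA : ∀ t, Measurable fun q : (Fin t → Observation X Y W) × X => A.act t q.1 q.2) (t : ℕ) :
    Measurable fun ω : ℕ → Z => env.transcript A ω t := by
  induction t using Nat.strong_induction_on with
  | _ t ih =>
    have hpre : Measurable fun ω : ℕ → Z => pre t (env.transcript A ω) :=
      measurable_pi_lambda _ fun i => ih i i.2
    have hinst : Measurable fun ω : ℕ → Z => env.inst (ω t) :=
      env.measurable_inst.comp (measurable_pi_apply t)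
    have hlabel : Measurable fun ω : ℕ → Z => env.label (ω t) :=
      env.measurable_label.comp (measurable_pi_apply t)
    have hact : Measurable fun ω : ℕ → Z =>
        A.act t (pre t (env.transcript A ω)) (env.inst (ω t)) :=
      (hA t).comp (hpre.prodMk hinst)
    simp_rw [transcript_eq]
    exact hinst.prodMk (hlabel.prodMk
      (env.measurable_feedback.comp ((measurable_pi_apply t).prodMk hact)))

lemma measurable_pre_transcript (env : Environment Z X Y E W) (A : Learner X Y E W)
    (hA : ∀ t, Measurable fun q : (Fin t → Observation X Y W) × X => A.act t q.1 q.2) (t : ℕ) :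
    Measurable fun ω : ℕ → Z => pre t (env.transcript A ω) :=
  measurable_pi_lambda _ fun i => env.measurable_transcript A hA i

/-- The event that `h` errs on the labeled example of a round. -/
def errorSet (env : Environment Z X Y E W) (h : X → Y) : Set Z :=
  {z | h (env.inst z) ≠ env.label z}

/-- The sample error of `h` in the `n₁` rounds from round `t` on, or in the rounds that follow up to
round `n`, is far from what the error of `h` on the distribution suggests. -/
def BadSample (env : Environment Z X Y E W) (α ε : ℝ) (n₁ n t : ℕ) (h : X → Y) (ω : ℕ → Z) :
    Prop :=
  (err h env.dist ≤ ENNReal.ofReal (ε + α) ∧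
    (ε + 9 / 8 * α) * n₁ < hitCount (env.errorSet h) ω (Finset.Ico t (t + n₁))) ∨
  (ENNReal.ofReal (ε + 5 / 4 * α) < err h env.dist ∧
    hitCount (env.errorSet h) ω (Finset.Ico t (t + n₁)) ≤ (ε + 9 / 8 * α) * n₁) ∨
  (err h env.dist ≤ ENNReal.ofReal (ε + 5 / 4 * α) ∧
    (ε + 3 / 2 * α) * n < hitCount (env.errorSet h) ω (Finset.Ico (t + n₁) n))

lemma badSample_splice (env : Environment Z X Y E W) (α ε : ℝ) (n₁ n t : ℕ) (h : X → Y)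
    (a b : ℕ → Z) :
    env.BadSample α ε n₁ n t h (splice t a b) ↔ env.BadSample α ε n₁ n t h b := by
  have h1 : hitCount (env.errorSet h) (splice t a b) (Finset.Ico t (t + n₁)) =
      hitCount (env.errorSet h) b (Finset.Ico t (t + n₁)) :=
    hitCount_congr fun i hi => splice_of_le (Finset.mem_Ico.1 hi).1 a b
  have h2 : hitCount (env.errorSet h) (splice t a b) (Finset.Ico (t + n₁) n) =
      hitCount (env.errorSet h) b (Finset.Ico (t + n₁) n) :=
    hitCount_congr fun i hi =>
      splice_of_le ((Nat.le_add_right _ _).trans (Finset.mem_Ico.1 hi).1) a b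
  rw [BadSample, BadSample, h1, h2]

variable [Finite Y] [DiscreteMeasurableSpace Y]

/-- `Y × Y` is again discrete since `Y` is finite, so its off-diagonal is measurable. -/
lemma measurableSet_ne_label {β : Type*} [MeasurableSpace β] {f g : β → Y} (hf : Measurable f)
    (hg : Measurable g) : MeasurableSet {x | f x ≠ g x} :=
  (hf.prodMk hg) (MeasurableSet.of_discrete (s := {q : Y × Y | q.1 ≠ q.2}))

lemma measurableSet_errorSet (env : Environment Z X Y E W) {h : X → Y} (hh : Measurable h) :
    MeasurableSet (env.errorSet h) :=
  measurableSet_ne_label (hh.comp env.measurable_inst) env.measurable_label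

lemma err_dist (env : Environment Z X Y E W) {h : X → Y} (hh : Measurable h) :
    err h env.dist = env.P (env.errorSet h) :=
  Measure.map_apply (env.measurable_inst.prodMk env.measurable_label)
    (measurableSet_ne_label (hh.comp measurable_fst) measurable_snd)

instance (env : Environment Z X Y E W) : IsProbabilityMeasure env.dist :=
  Measure.isProbabilityMeasure_map
    (env.measurable_inst.prodMk env.measurable_label).aemeasurable

instance (env : Environment Z X Y E W) : IsProbabilityMeasure env.streamLaw := by
  unfold streamLaw; infer_instance

/-- The hypothesis may vary with the stream, as it will be read off a transcript; joint
measurability makes its error a measurable function of `ω`. -/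
lemma measurableSet_badSample (env : Environment Z X Y E W) (α ε : ℝ) (n₁ n t : ℕ)
    {G : (ℕ → Z) → X → Y} (hG : Measurable fun q : (ℕ → Z) × X => G q.1 q.2) :
    MeasurableSet {ω | env.BadSample α ε n₁ n t (G ω) ω} := by
  have herr : Measurable fun ω => err (G ω) env.dist := by
    have hs : MeasurableSet {q : (ℕ → Z) × (X × Y) | G q.1 q.2.1 ≠ q.2.2} :=
      measurableSet_ne_label
        (hG.comp (measurable_fst.prodMk (measurable_fst.comp measurable_snd)))
        (measurable_snd.comp measurable_snd)
    exact measurable_measure_prodMk_left hs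
  have hcount : ∀ I : Finset ℕ,
      Measurable fun ω => (hitCount (env.errorSet (G ω)) ω I : ℝ) := by
    intro I
    simp_rw [hitCount_eq_sum_indicator]
    refine Finset.measurable_sum _ fun i _ => ?_
    have hs : MeasurableSet {ω : ℕ → Z | G ω (env.inst (ω i)) ≠ env.label (ω i)} :=
      measurableSet_ne_label
        (hG.comp (measurable_id.prodMk (env.measurable_inst.comp (measurable_pi_apply i))))
        (env.measurable_label.comp (measurable_pi_apply i))
    exact (measurable_one (α := ℝ)).indicator hs
  exact ((measurableSet_le herr measurable_const).inter
      (measurableSet_lt measurable_const (hcount _))).union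
    (((measurableSet_lt measurable_const herr).inter
      (measurableSet_le (hcount _) measurable_const)).union
    ((measurableSet_le herr measurable_const).inter
      (measurableSet_lt measurable_const (hcount _))))

/-- For a fixed hypothesis a bad sample is unlikely. -/
lemma streamLaw_badSample_le (env : Environment Z X Y E W) {α ε L : ℝ} {n₁ n t : ℕ} (hα : 0 < α)
    (hε : 0 ≤ ε) (hn₁ : 320 * (ε + α) / α ^ 2 * L ≤ n₁) (hn : 320 * (ε + α) / α ^ 2 * L ≤ n)
    {h : X → Y} (hh : Measurable h) :
    env.streamLaw {ω | env.BadSample α ε n₁ n t h ω} ≤ ENNReal.ofReal (3 * Real.exp (-L)) := by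
  have hV := env.measurableSet_errorSet hh
  -- The tightest use has `s = α / 8` and `q = ε + 5/4 α`; it needs `4 q ≤ 5 (ε + α)`, whence `320 =
  -- 64 * 5`.
  have hexp : ∀ {m s q : ℝ}, 320 * (ε + α) / α ^ 2 * L ≤ m → 0 < q → 0 ≤ m →
      α ^ 2 * (4 * q) ≤ s ^ 2 * (320 * (ε + α)) →
      Real.exp (-(m * (s ^ 2 / (4 * q)))) ≤ Real.exp (-L) := by
    intro m s q hm hq hm0 hs
    rw [Real.exp_le_exp, neg_le_neg_iff]
    have h1 : α ^ 2 / (320 * (ε + α)) ≤ s ^ 2 / (4 * q) := by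
      rw [div_le_div_iff₀ (by positivity) (by positivity)]; exact hs
    calc L = 320 * (ε + α) / α ^ 2 * L * (α ^ 2 / (320 * (ε + α))) := by
          have : ε + α ≠ 0 := by positivity
          field_simp
      _ ≤ m * (s ^ 2 / (4 * q)) := by gcongr
  have hle : ∀ {q : ℝ}, 0 ≤ q → err h env.dist ≤ ENNReal.ofReal q →
      env.P.real (env.errorSet h) ≤ q := fun hq hl => by
    rw [env.err_dist hh] at hl
    exact ENNReal.toReal_le_of_le_ofReal hq hl
  have key : ∀ {U V : Set (ℕ → Z)} {p : Prop}, U ⊆ {ω | p ∧ ω ∈ V} →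
      (p → env.streamLaw.real V ≤ Real.exp (-L)) →
      env.streamLaw.real U ≤ Real.exp (-L) := by
    intro U V p hU hV
    by_cases hp : p
    · exact (measureReal_mono fun ω hω => (hU hω).2).trans (hV hp)
    · have : U = ∅ := Set.eq_empty_of_forall_notMem fun ω hω => hp (hU hω).1
      simp [this, Real.exp_nonneg]
  have hcard : (Finset.Ico t (t + n₁)).card = n₁ := by simp
  have h1 := key (U := {ω | err h env.dist ≤ ENNReal.ofReal (ε + α) ∧
    (ε + 9 / 8 * α) * n₁ < hitCount (env.errorSet h) ω (Finset.Ico t (t + n₁))})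
    (V := {ω | (ε + α + α / 8) * n₁ ≤
      hitCount (env.errorSet h) ω (Finset.Ico t (t + n₁))})
    (fun ω hω => ⟨hω.1, by
      have := hω.2.le
      rw [Set.mem_ofPred_eq]
      linarith⟩)
    (fun hp => (measureReal_le_hitCount_le hV (by rw [hcard]) (hle (by positivity) hp)
      (by positivity) (by positivity) (by linarith)).trans
      (hexp hn₁ (by positivity) (by positivity) (by
        have : 0 ≤ α ^ 2 * (ε + α) := by positivity
        nlinarith)))
  have h2 := key (U := {ω | ENNReal.ofReal (ε + 5 / 4 * α) < err h env.dist ∧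
    hitCount (env.errorSet h) ω (Finset.Ico t (t + n₁)) ≤ (ε + 9 / 8 * α) * n₁})
    (V := {ω | hitCount (env.errorSet h) ω (Finset.Ico t (t + n₁)) ≤
      (ε + 5 / 4 * α - α / 8) * (Finset.Ico t (t + n₁)).card})
    (fun ω hω => ⟨hω.1, by
      have := hω.2
      rw [Set.mem_ofPred_eq]
      rw [hcard]
      linarith⟩)
    (fun hp => (measureReal_hitCount_le_le hV (by
        rw [env.err_dist hh] at hp
        exact (ENNReal.ofReal_le_iff_le_toReal (measure_ne_top _ _)).1 hp.le)
      (by positivity) (by positivity) (by linarith)).trans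
      (hexp (by rw [hcard]; exact hn₁) (by positivity) (by positivity) (by
        have : 0 ≤ α ^ 2 * (ε + α) := by positivity
        have : 0 ≤ α ^ 2 * ε := by positivity
        nlinarith)))
  have h3 := key (U := {ω | err h env.dist ≤ ENNReal.ofReal (ε + 5 / 4 * α) ∧
    (ε + 3 / 2 * α) * n < hitCount (env.errorSet h) ω (Finset.Ico (t + n₁) n)})
    (V := {ω | (ε + 5 / 4 * α + α / 4) * n ≤
      hitCount (env.errorSet h) ω (Finset.Ico (t + n₁) n)})
    (fun ω hω => ⟨hω.1, by
      have := hω.2.le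
      rw [Set.mem_ofPred_eq]
      linarith⟩)
    -- The last window may be short or empty; its count is compared with a fraction of the full
    -- length `n`.
    (fun hp => (measureReal_le_hitCount_le hV (by
        rw [Nat.card_Ico]; exact_mod_cast Nat.sub_le _ _) (hle (by positivity) hp)
      (by positivity) (by positivity) (by linarith)).trans
      (hexp hn (by positivity) (by positivity) (by
        have : 0 ≤ α ^ 2 * (ε + α) := by positivity
        have : 0 ≤ α ^ 2 * ε := by positivity
        nlinarith)))
  rw [← ofReal_measureReal]
  refine ENNReal.ofReal_le_ofReal ?_
  refine (measureReal_union_le _ _).trans ?_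
  refine (add_le_add h1 ((measureReal_union_le _ _).trans (add_le_add h2 h3))).trans ?_
  linarith

/-- For a small class it is unlikely that the sample is bad for one of the hypotheses. -/
lemma streamLaw_exists_badSample_le (env : Environment Z X Y E W) {α ε L : ℝ} {n₁ n t : ℕ}
    (hα : 0 < α) (hε : 0 ≤ ε) (hn₁ : 320 * (ε + α) / α ^ 2 * L ≤ n₁)
    (hn : 320 * (ε + α) / α ^ 2 * L ≤ n) {K : Set (X → Y)} (hK : K.Finite)
    (hmeas : ∀ h ∈ K, Measurable h) :
    env.streamLaw {ω | ∃ h ∈ K, env.BadSample α ε n₁ n t h ω} ≤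
      ENNReal.ofReal (K.ncard * (3 * Real.exp (-L))) := by
  have hsub : {ω | ∃ h ∈ K, env.BadSample α ε n₁ n t h ω} ⊆
      ⋃ h ∈ hK.toFinset, {ω | env.BadSample α ε n₁ n t h ω} := by
    rintro ω ⟨h, hhK, hb⟩
    simp only [Set.mem_iUnion]
    exact ⟨h, hK.mem_toFinset.2 hhK, hb⟩
  refine (measure_mono hsub).trans ((measure_biUnion_finset_le _ _).trans ?_)
  refine (Finset.sum_le_card_nsmul _ _ _ fun h hh => env.streamLaw_badSample_le hα hε hn₁ hn
    (hmeas h (hK.mem_toFinset.1 hh))).trans ?_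
  rw [nsmul_eq_mul, ENNReal.ofReal_mul (Nat.cast_nonneg _), ENNReal.ofReal_natCast,
    Set.ncard_eq_toFinset_card K hK]

end Environment

/-! ### The algorithm. -/

section Algorithm

variable {X : Type uX} {Y : Type uY} {E : Type uE} {W : Type uW} {Θ : Type uT}
  {Φ : Set (X → Bool)}

namespace DiscoveryProtocol

variable (π : DiscoveryProtocol Y E W Φ)

lemma StopsAt.unique {π : DiscoveryProtocol Y E W Φ} {o : ℕ → Observation X Y W} {s t : ℕ}
    {F G : Set Φ} (hs : π.StopsAt o s F) (ht : π.StopsAt o t G) : s = t ∧ F = G := by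
  have key : ∀ {s t : ℕ} {F G : Set Φ}, π.StopsAt o s F → π.StopsAt o t G → ¬ s < t := by
    intro s t F G hs ht hlt
    have := ht.1 s hlt
    rw [hs.2] at this
    exact Option.some_ne_none _ this
  obtain rfl : s = t := le_antisymm (not_lt.1 (key ht hs)) (not_lt.1 (key hs ht))
  exact ⟨rfl, Option.some.inj (hs.2.symm.trans ht.2)⟩

lemma exists_stopsAt_of_not_runsUntil {o : ℕ → Observation X Y W} {n : ℕ}
    (h : ¬ π.RunsUntil o n) : ∃ τ < n, ∃ F, π.StopsAt o τ F := by
  classical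
  have hex : ∃ s, π.output s (pre s o) ≠ none := by
    by_contra! hc
    exact h fun s _ => hc s
  obtain ⟨F, hF⟩ := Option.ne_none_iff_exists'.1 (Nat.find_spec hex)
  refine ⟨Nat.find hex, ?_, F, fun s hs => not_not.1 (Nat.find_min hex hs), hF⟩
  by_contra! hc
  exact h fun s hs => not_not.1 (Nat.find_min hex (hs.trans_le hc))

/-- The finite sequence of observations `o` leads the protocol to stop after `s` observations with
output `F`. -/
def StopsIn {t : ℕ} (o : Fin t → Observation X Y W) (s : ℕ) (F : Set Φ) : Prop :=
  ∃ hst : s ≤ t,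
    (∀ r, ∀ hr : r < s, π.output r (fun i => o (Fin.castLE (hr.le.trans hst) i)) = none) ∧
    π.output s (fun i => o (Fin.castLE hst i)) = some F

lemma stopsIn_pre {o : ℕ → Observation X Y W} {s t : ℕ} {F : Set Φ} :
    π.StopsIn (pre t o) s F ↔ s ≤ t ∧ π.StopsAt o s F := by
  constructor
  · rintro ⟨h, h1, h2⟩
    exact ⟨h, h1, h2⟩
  · rintro ⟨h, h1, h2⟩
    exact ⟨h, h1, h2⟩

end DiscoveryProtocol

/-- The part of the observations `o` which are the labeled examples number `s` to `s + m - 1`. -/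
def exampleBlock {t s m : ℕ} (h : s + m ≤ t) (o : Fin t → Observation X Y W) : Fin m → X × Y :=
  fun i => ((o ⟨s + i, by omega⟩).1, (o ⟨s + i, by omega⟩).2.1)

open Classical in
/-- An empirical risk minimizer of the class `K`, or `h₀` if there is none. -/
noncomputable def chooseERM {m : ℕ} (K : Set (X → Y)) (S : Fin m → X × Y) (h₀ : X → Y) : X → Y :=
  if h : ∃ h, IsERM K S h then h.choose else h₀

/-- The fallback used by `discoverThenERM` changes from round to round, whereas `DiscoversThenERM`
asks for one hypothesis for all later rounds. -/
lemma chooseERM_congr {m : ℕ} {K : Set (X → Y)} {S : Fin m → X × Y} (h : ∃ h, IsERM K S h)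
    (h₀ h₁ : X → Y) : chooseERM K S h₀ = chooseERM K S h₁ := by
  rw [chooseERM, chooseERM, dif_pos h, dif_pos h]

lemma isERM_chooseERM {m : ℕ} {K : Set (X → Y)} (hK : K.Finite) (hne : K.Nonempty)
    (S : Fin m → X × Y) (h₀ : X → Y) : IsERM K S (chooseERM K S h₀) := by
  have h : ∃ h, IsERM K S h := hK.exists_minimalFor (fun h => empErr h S) K hne |>.imp
    fun h hh => ⟨hh.1, fun h' hh' => (le_total (empErr h S) (empErr h' S)).elim id (hh.2 hh')⟩
  rw [chooseERM, dif_pos h]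
  exact h.choose_spec

open Classical in
/-- The learner which runs a feature discovery protocol, collects `n₁` further labeled examples and
then predicts with an empirical risk minimizer of the class that the protocol has returned. -/
noncomputable def discoverThenERM (p : FeedbackProtocol X Y E W Θ) (π : DiscoveryProtocol Y E W Φ)
    (H : FeatureClass Y Φ) (n₁ : ℕ) : Learner X Y E W where
  act t o x :=
    if h : ∃ q : ℕ × Set Φ, π.StopsIn o q.1 q.2 ∧ q.1 + n₁ ≤ t then
      let y := chooseERM (H.cls h.choose.2) (exampleBlock h.choose_spec.2 o)
        (fun x => (π.act t o x).1) x
      (y, (p.allowed_nonempty t (fun i => ((o i).1, (o i).2.1)) x y).some)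
    else π.act t o x

variable {p : FeedbackProtocol X Y E W Θ} {π : DiscoveryProtocol Y E W Φ} {H : FeatureClass Y Φ}
  {n₁ : ℕ}

lemma discoverThenERM_obeys (hπ : π.toLearner.Obeys p) : (discoverThenERM p π H n₁).Obeys p := by
  intro t o x
  by_cases h : ∃ q : ℕ × Set Φ, π.StopsIn o q.1 q.2 ∧ q.1 + n₁ ≤ t
  · simp only [discoverThenERM, dif_pos h]
    exact Set.Nonempty.some_mem _
  · simp only [discoverThenERM, dif_neg h]
    exact hπ t o x

lemma discoverThenERM_discoversThenERM (p : FeedbackProtocol X Y E W Θ)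
    (π : DiscoveryProtocol Y E W Φ) (H : FeatureClass Y Φ) (n₁ : ℕ) :
    (discoverThenERM p π H n₁).DiscoversThenERM π H n₁ := by
  intro o
  constructor
  · intro t ht x
    have h : ¬ ∃ q : ℕ × Set Φ, π.StopsIn (pre t o) q.1 q.2 ∧ q.1 + n₁ ≤ t := by
      rintro ⟨q, hq, -⟩
      obtain ⟨hqt, hq⟩ := π.stopsIn_pre.1 hq
      have := ht q.1 (Nat.lt_succ_of_le hqt)
      rw [hq.2] at this
      exact Option.some_ne_none _ this
    simp only [discoverThenERM, dif_neg h]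
  · intro τ F hF hfin hne
    refine ⟨_, isERM_chooseERM hfin hne _ hne.some, fun t ht x => ?_⟩
    have h : ∃ q : ℕ × Set Φ, π.StopsIn (pre t o) q.1 q.2 ∧ q.1 + n₁ ≤ t :=
      ⟨(τ, F), π.stopsIn_pre.2 ⟨(Nat.le_add_right _ _).trans ht, hF⟩, ht⟩
    simp only [discoverThenERM, dif_pos h]
    obtain ⟨e1, e2⟩ := (π.stopsIn_pre.1 h.choose_spec.1).2.unique hF
    -- Generalizing over `q` allows substitution although the type of the bound `hq` mentions it.
    have key : ∀ (q : ℕ × Set Φ) (hq : q.1 + n₁ ≤ t), q = (τ, F) →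
        chooseERM (H.cls q.2) (exampleBlock hq (pre t o)) (fun x => (π.act t (pre t o) x).1) x =
        chooseERM (H.cls F) (fun i : Fin n₁ => ((o (τ + i)).1, (o (τ + i)).2.1)) hne.some x := by
      rintro q hq rfl
      exact congrFun (chooseERM_congr ⟨_, isERM_chooseERM hfin hne _ hne.some⟩ _ _) x
    exact key _ _ (Prod.ext e1 e2)

end Algorithm

/-! ### Pathwise count of the mistakes. -/

namespace Environment

variable {Z : Type uZ} {X : Type uX} {Y : Type uY} {E : Type uE} {W : Type uW}
  [MeasurableSpace Z] [MeasurableSpace X] [MeasurableSpace Y] [MeasurableSpace E]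
  [MeasurableSpace W] {Φ : Set (X → Bool)} {π : DiscoveryProtocol Y E W Φ} {A : Learner X Y E W}
  {H : FeatureClass Y Φ} {n₁ : ℕ}

/-- Feedback depends on the actions, so the agreement of actions and of transcripts is proved by a
joint induction. -/
lemma pre_transcript_eq_of_runsUntil (env : Environment Z X Y E W)
    (hA : A.DiscoversThenERM π H n₁) {ω : ℕ → Z} {t : ℕ}
    (ht : π.RunsUntil (env.transcript π.toLearner ω) t) :
    pre t (env.transcript A ω) = pre t (env.transcript π.toLearner ω) := by
  induction t with
  | zero => exact funext fun i => i.elim0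
  | succ t ih =>
    have ih' := ih fun s hs => ht s (hs.trans t.lt_succ_self)
    ext i : 1
    rcases Nat.lt_succ_iff_lt_or_eq.1 i.2 with hi | hi
    · exact congrFun ih' ⟨i, hi⟩
    · simp only [pre, hi]
      rw [transcript_eq, transcript_eq, ih', (hA _).1 t ht]

lemma runsUntil_transcript (env : Environment Z X Y E W)
    (hA : A.DiscoversThenERM π H n₁) {ω : ℕ → Z} {t : ℕ}
    (ht : π.RunsUntil (env.transcript π.toLearner ω) t) :
    ∀ s ≤ t, pre s (env.transcript A ω) = pre s (env.transcript π.toLearner ω) :=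
  fun _ hs => env.pre_transcript_eq_of_runsUntil hA fun r hr => ht r (hr.trans_le hs)

lemma stopsAt_transcript (env : Environment Z X Y E W)
    (hA : A.DiscoversThenERM π H n₁) {ω : ℕ → Z} {t : ℕ} {F : Set Φ}
    (ht : π.StopsAt (env.transcript π.toLearner ω) t F) :
    π.StopsAt (env.transcript A ω) t F := by
  have h := env.runsUntil_transcript hA ht.1
  exact ⟨fun s hs => by rw [h s hs.le]; exact ht.1 s hs, by rw [h t le_rfl]; exact ht.2⟩

lemma mistakes_eq_of_runsUntil (env : Environment Z X Y E W)
    (hA : A.DiscoversThenERM π H n₁) {ω : ℕ → Z} {t : ℕ}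
    (ht : π.RunsUntil (env.transcript π.toLearner ω) t) :
    env.mistakes A ω t = env.mistakes π.toLearner ω t := by
  classical
  unfold mistakes
  congr 1
  refine Finset.filter_congr fun s hs => ?_
  have hs := Finset.mem_range.1 hs
  rw [prediction, prediction, env.runsUntil_transcript hA ht s hs.le,
    (hA _).1 s fun r hr => ht r (hr.trans_le hs)]

/-- Instances and labels do not depend on what the learner does, so the training sample is a plain
block of the i.i.d. stream. -/
lemma empErr_transcript (env : Environment Z X Y E W) (A : Learner X Y E W) (ω : ℕ → Z)
    (h : X → Y) (t m : ℕ) :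
    empErr h (fun i : Fin m => ((env.transcript A ω (t + i)).1,
      (env.transcript A ω (t + i)).2.1)) =
      (hitCount (env.errorSet h) ω (Finset.Ico t (t + m)) : ℝ) / m := by
  classical
  unfold empErr
  congr 2
  unfold hitCount
  refine Finset.card_bij (fun i _ => t + i) ?_ ?_ ?_
  · intro i hi
    have := (Finset.mem_filter.1 hi).2
    simp only [transcript_eq] at this
    exact Finset.mem_filter.2 ⟨Finset.mem_Ico.2 ⟨by omega, by omega⟩, this⟩
  · intro i _ j _ hij
    exact Fin.ext (by omega)
  · intro j hj
    obtain ⟨hj, hj'⟩ := Finset.mem_filter.1 hj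
    have hj := Finset.mem_Ico.1 hj
    refine ⟨⟨j - t, by omega⟩, Finset.mem_filter.2 ⟨Finset.mem_univ _, ?_⟩, ?_⟩
    · simp only [transcript_eq, Nat.add_sub_cancel' hj.1]
      exact hj'
    · simp only [Nat.add_sub_cancel' hj.1]

lemma mistakes_le (env : Environment Z X Y E W) (A : Learner X Y E W) (ω : ℕ → Z) (h : X → Y)
    (n m t : ℕ) (hh : ∀ s, t + m ≤ s → env.prediction A ω s = h (env.inst (ω s))) :
    env.mistakes A ω n ≤ env.mistakes A ω t + m +
      hitCount (env.errorSet h) ω (Finset.Ico (t + m) n) := by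
  classical
  have hsub : ((Finset.range n).filter fun s => env.prediction A ω s ≠ env.label (ω s)) ⊆
      (((Finset.range t).filter fun s => env.prediction A ω s ≠ env.label (ω s)) ∪
        Finset.Ico t (t + m)) ∪
        (Finset.Ico (t + m) n).filter fun s => ω s ∈ env.errorSet h := by
    intro s hs
    obtain ⟨hs, hs'⟩ := Finset.mem_filter.1 hs
    have hs := Finset.mem_range.1 hs
    simp only [Finset.mem_union, Finset.mem_filter, Finset.mem_range, Finset.mem_Ico]
    by_cases h1 : s < t
    · exact Or.inl (Or.inl ⟨h1, hs'⟩)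
    by_cases h2 : s < t + m
    · exact Or.inl (Or.inr ⟨not_lt.1 h1, h2⟩)
    · refine Or.inr ⟨⟨not_lt.1 h2, hs⟩, ?_⟩
      rw [hh s (not_lt.1 h2)] at hs'
      exact hs'
  unfold mistakes hitCount
  refine (Finset.card_le_card hsub).trans ((Finset.card_union_le _ _).trans ?_)
  gcongr
  refine (Finset.card_union_le _ _).trans ?_
  rw [Nat.card_Ico, Nat.add_sub_cancel_left]

/-- On a stream without bad samples, the class returned by the discovery protocol contributes few
mistakes. -/
lemma mistakes_le_of_not_badSample (env : Environment Z X Y E W)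
    (hA : A.DiscoversThenERM π H n₁) (hn₁ : 0 < n₁) {α ε : ℝ} {n t : ℕ}
    {ω : ℕ → Z} {F : Set Φ}
    (ht : π.StopsAt (env.transcript π.toLearner ω) t F) (hfin : (H.cls F).Finite)
    (herr : classErr (H.cls F) env.dist ≤ ENNReal.ofReal (ε + α))
    (hbad : ∀ h ∈ H.cls F, ¬ env.BadSample α ε n₁ n t h ω) :
    (env.mistakes A ω n : ℝ) ≤
      env.mistakes π.toLearner ω t + n₁ + (ε + 3 / 2 * α) * n := by
  -- The empty class has error `⊤`.
  have hne : (H.cls F).Nonempty := by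
    by_contra hc
    rw [Set.not_nonempty_iff_eq_empty.1 hc] at herr
    simp [classErr] at herr
  obtain ⟨g, hg, hgmin⟩ := hfin.exists_minimalFor (fun h => err h env.dist) _ hne
  have hgerr : err g env.dist ≤ ENNReal.ofReal (ε + α) :=
    le_trans (le_iInf₂ fun h hh => (le_total (err g env.dist) (err h env.dist)).elim id
      (hgmin hh)) herr
  obtain ⟨h, ⟨hh, hmin⟩, hpred⟩ := (hA _).2 t F (env.stopsAt_transcript hA ht) hfin hne
  have hg' := hbad g hg
  have hh' := hbad h hh
  simp only [BadSample, not_or, not_and, not_lt, not_le] at hg' hh'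
  have hle := hmin g hg
  rw [empErr_transcript, empErr_transcript, div_le_div_iff_of_pos_right (by positivity)] at hle
  -- The best hypothesis `g` stays below the `9/8` level on the sample, hence so does the minimizer
  -- `h`; an `h` with error above `5/4` would exceed that level.
  have hherr : err h env.dist ≤ ENNReal.ofReal (ε + 5 / 4 * α) := by
    by_contra hc
    exact absurd (hh'.2.1 (not_le.1 hc)) (not_lt.2 (hle.trans (hg'.1 hgerr)))
  have h3 := hh'.2.2 hherr
  have h4 := env.mistakes_le A ω h n n₁ t fun s hs => hpred s hs _
  rw [env.mistakes_eq_of_runsUntil hA ht.1] at h4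
  have h5 : (env.mistakes A ω n : ℝ) ≤ env.mistakes π.toLearner ω t + n₁ +
      hitCount (env.errorSet h) ω (Finset.Ico (t + n₁) n) := by exact_mod_cast h4
  linarith

end Environment

/-! ### Bad samples after a random stopping time. -/

namespace Environment

variable {Z : Type uZ} {X : Type uX} {Y : Type uY} {E : Type uE} {W : Type uW}
  [MeasurableSpace Z] [MeasurableSpace X] [MeasurableSpace Y] [MeasurableSpace E]
  [MeasurableSpace W] {Φ : Set (X → Bool)} {π : DiscoveryProtocol Y E W Φ}
  {H : FeatureClass Y Φ}

/-- The event that the discovery protocol stops after `t` observations. -/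
def stopSet (env : Environment Z X Y E W) (π : DiscoveryProtocol Y E W Φ) (t : ℕ) :
    Set (ℕ → Z) :=
  {ω | ∃ F, π.StopsAt (env.transcript π.toLearner ω) t F}

lemma measurableSet_stopSet (env : Environment Z X Y E W) (hπ : π.IsMeasurable H) (t : ℕ) :
    MeasurableSet (env.stopSet π t) := by
  have hnone : ∀ s, MeasurableSet
      {ω : ℕ → Z | π.output s (pre s (env.transcript π.toLearner ω)) = none} := fun s =>
    env.measurable_pre_transcript π.toLearner hπ.act s (hπ.halts s)
  have heq : env.stopSet π t =
      (⋂ s ∈ Finset.range t,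
        {ω : ℕ → Z | π.output s (pre s (env.transcript π.toLearner ω)) = none}) ∩
      {ω : ℕ → Z | π.output t (pre t (env.transcript π.toLearner ω)) = none}ᶜ := by
    ext ω
    simp only [stopSet, Set.mem_ofPred_eq, DiscoveryProtocol.StopsAt,
      DiscoveryProtocol.RunsUntil, Set.mem_inter_iff, Set.mem_iInter, Finset.mem_range,
      Set.mem_compl_iff, exists_and_left]
    exact and_congr_right fun _ => Option.ne_none_iff_exists'.symm
  rw [heq]
  exact (Finset.measurableSet_biInter _ fun s _ => hnone s).inter (hnone t).compl

lemma stopsAt_splice (env : Environment Z X Y E W) (π : DiscoveryProtocol Y E W Φ) {t : ℕ}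
    {F : Set Φ} (a b : ℕ → Z) :
    π.StopsAt (env.transcript π.toLearner (splice t a b)) t F ↔
      π.StopsAt (env.transcript π.toLearner a) t F := by
  unfold DiscoveryProtocol.StopsAt DiscoveryProtocol.RunsUntil
  rw [env.pre_transcript_splice π.toLearner le_rfl]
  refine and_congr_left fun _ => forall₂_congr fun s hs => ?_
  rw [env.pre_transcript_splice π.toLearner hs.le]

lemma disjoint_stopSet (env : Environment Z X Y E W) (π : DiscoveryProtocol Y E W Φ) {s t : ℕ}
    (hst : s ≠ t) : Disjoint (env.stopSet π s) (env.stopSet π t) := by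
  rw [Set.disjoint_left]
  rintro ω ⟨F, hF⟩ ⟨G, hG⟩
  exact hst (hF.unique hG).1

variable [Finite Y] [DiscreteMeasurableSpace Y]

/-- It is unlikely that the discovery protocol stops after `t` observations and the sample that
follows is bad for a hypothesis of the class it has returned. -/
lemma streamLaw_stopsAt_badSample_le (env : Environment Z X Y E W) (hπ : π.IsMeasurable H)
    {α ε L N : ℝ} {n₁ n : ℕ} (t : ℕ) (hα : 0 < α) (hε : 0 ≤ ε)
    (hn₁ : 320 * (ε + α) / α ^ 2 * L ≤ n₁) (hn : 320 * (ε + α) / α ^ 2 * L ≤ n)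
    (hcap : ∀ᵐ ω ∂env.streamLaw, ∀ F, π.StopsAt (env.transcript π.toLearner ω) t F →
      (H.cls F).Finite ∧ ((H.cls F).ncard : ℝ) ≤ N) :
    env.streamLaw {ω | ∃ F, π.StopsAt (env.transcript π.toLearner ω) t F ∧ (H.cls F).Finite ∧
        ∃ h ∈ H.cls F, env.BadSample α ε n₁ n t h ω} ≤
      ENNReal.ofReal (N * (3 * Real.exp (-L))) * env.streamLaw (env.stopSet π t) := by
  obtain ⟨g, S, hg, hS, hgS⟩ := hπ.cls t
  set v : (ℕ → Z) → Fin t → Observation X Y W := fun ω => pre t (env.transcript π.toLearner ω)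
  have hv : Measurable v := env.measurable_pre_transcript π.toLearner hπ.act t
  have hvs : ∀ a b, v (splice t a b) = v a := env.pre_transcript_splice π.toLearner le_rfl
  have hstopSet := env.measurableSet_stopSet hπ t
  -- A measurable superset: quantification over arbitrary feature sets `F` is replaced by the
  -- countable list of hypotheses.
  set B : Set (ℕ → Z) := env.stopSet π t ∩
    ⋃ k, v ⁻¹' S k ∩ {ω | env.BadSample α ε n₁ n t (g k (v ω)) ω}
  have hB : MeasurableSet B :=
    hstopSet.inter <| MeasurableSet.iUnion fun k => (hv (hS k)).inter <|
      env.measurableSet_badSample α ε n₁ n t (G := fun ω => g k (v ω))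
        ((hg k).comp ((hv.comp measurable_fst).prodMk measurable_snd))
  have hsub : {ω | ∃ F, π.StopsAt (env.transcript π.toLearner ω) t F ∧ (H.cls F).Finite ∧
      ∃ h ∈ H.cls F, env.BadSample α ε n₁ n t h ω} ⊆ B := by
    rintro ω ⟨F, hF, hfin, h, hh, hbad⟩
    rw [hgS _ F hF.2 hfin] at hh
    obtain ⟨k, hk, rfl⟩ := hh
    exact ⟨⟨F, hF⟩, Set.mem_iUnion.2 ⟨k, hk, hbad⟩⟩
  refine (measure_mono hsub).trans ?_
  refine measure_le_mul_of_splice (t := t) hB hstopSet ?_ ?_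
  · rintro a b ⟨⟨F, hF⟩, -⟩
    exact ⟨F, (env.stopsAt_splice π a b).1 hF⟩
  -- The capacity bound concerns only the prefix `a`, so the continuation `b₀` serves to establish
  -- it.
  filter_upwards [ae_of_ae_of_forall_splice (t := t) hcap] with a ⟨b₀, hb₀⟩ ⟨F, hF⟩
  obtain ⟨hfin, hcard⟩ := hb₀ F ((env.stopsAt_splice π a b₀).2 hF)
  have hcls := hgS _ F hF.2 hfin
  have hmeas : ∀ h ∈ H.cls F, Measurable h := by
    intro h hh
    rw [hcls] at hh
    obtain ⟨k, -, rfl⟩ := hh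
    exact (hg k).comp measurable_prodMk_left
  refine le_trans (measure_mono ?_)
    ((env.streamLaw_exists_badSample_le (t := t) hα hε hn₁ hn hfin hmeas).trans
      (ENNReal.ofReal_le_ofReal (by gcongr)))
  rintro b ⟨-, hb⟩
  obtain ⟨k, hk, hbad⟩ := Set.mem_iUnion.1 hb
  rw [Set.mem_preimage, hvs] at hk
  rw [Set.mem_ofPred_eq, hvs, badSample_splice] at hbad
  exact ⟨g k (v a), by rw [hcls]; exact ⟨k, hk, rfl⟩, hbad⟩

/-- The protocol stops at most once, so the stopping probabilities sum to at most one and no factor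
`n` appears. -/
lemma streamLaw_exists_stopsAt_badSample_le (env : Environment Z X Y E W)
    (hπ : π.IsMeasurable H) {α ε L N : ℝ} {n₁ n : ℕ} (hα : 0 < α) (hε : 0 ≤ ε)
    (hn₁ : 320 * (ε + α) / α ^ 2 * L ≤ n₁) (hn : 320 * (ε + α) / α ^ 2 * L ≤ n)
    (hcap : ∀ᵐ ω ∂env.streamLaw, ∀ t F, π.StopsAt (env.transcript π.toLearner ω) t F →
      (H.cls F).Finite ∧ ((H.cls F).ncard : ℝ) ≤ N) :
    env.streamLaw {ω | ∃ t < n, ∃ F, π.StopsAt (env.transcript π.toLearner ω) t F ∧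
        (H.cls F).Finite ∧ ∃ h ∈ H.cls F, env.BadSample α ε n₁ n t h ω} ≤
      ENNReal.ofReal (N * (3 * Real.exp (-L))) := by
  set c := ENNReal.ofReal (N * (3 * Real.exp (-L)))
  have hsub : {ω | ∃ t < n, ∃ F, π.StopsAt (env.transcript π.toLearner ω) t F ∧
        (H.cls F).Finite ∧ ∃ h ∈ H.cls F, env.BadSample α ε n₁ n t h ω} ⊆
      ⋃ t ∈ Finset.range n, {ω | ∃ F, π.StopsAt (env.transcript π.toLearner ω) t F ∧
        (H.cls F).Finite ∧ ∃ h ∈ H.cls F, env.BadSample α ε n₁ n t h ω} := by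
    rintro ω ⟨t, ht, h⟩
    simp only [Set.mem_iUnion]
    exact ⟨t, Finset.mem_range.2 ht, h⟩
  refine (measure_mono hsub).trans ((measure_biUnion_finset_le _ _).trans ?_)
  calc _ ≤ ∑ t ∈ Finset.range n, c * env.streamLaw (env.stopSet π t) :=
        Finset.sum_le_sum fun t _ => env.streamLaw_stopsAt_badSample_le hπ t hα hε hn₁ hn
          (hcap.mono fun ω h => h t)
    _ = c * env.streamLaw (⋃ t ∈ Finset.range n, env.stopSet π t) := by
        rw [← Finset.mul_sum, measure_biUnion_finset
          (fun s _ t _ hst => env.disjoint_stopSet π hst)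
          (fun t _ => env.measurableSet_stopSet hπ t)]
    _ ≤ c * 1 := by gcongr; exact prob_le_one
    _ = c := mul_one c

end Environment

/-! ### Numerical estimates. -/

lemma le_two_pow_of_logb_le {m d : ℕ} (h : Real.logb 2 (m : ℝ) ≤ d) : (m : ℝ) ≤ 2 ^ d := by
  rcases Nat.eq_zero_or_pos m with rfl | hm
  · simp
  · rw [Real.logb_le_iff_le_rpow one_lt_two (by positivity), Real.rpow_natCast] at h
    exact h

/-- The factor `2` in the exponent yields `exp(-2) ^ d`, which beats `2 ^ d`, and `δ ^ 2`, which
absorbs the `3` because `3 δ ≤ 1`. -/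
lemma two_pow_mul_exp_le {δ : ℝ} (d : ℕ) (hδ : 0 < δ) (hδ' : δ ≤ 1 / 3) :
    (2 : ℝ) ^ d * (3 * Real.exp (-(2 * (d + Real.log (1 / δ))))) ≤ δ := by
  have h1 : Real.exp (-(2 * (d + Real.log (1 / δ)))) = Real.exp (-2) ^ d * δ ^ 2 := by
    have h : δ ^ 2 = Real.exp (2 * Real.log δ) := by
      rw [two_mul, Real.exp_add, Real.exp_log hδ, sq]
    rw [one_div, Real.log_inv, ← Real.exp_nat_mul, h, ← Real.exp_add]
    congr 1
    ring
  have h2 : (2 : ℝ) ^ d * Real.exp (-2) ^ d ≤ 1 := by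
    rw [← mul_pow]
    refine pow_le_one₀ (by positivity) ?_
    have h := Real.add_one_le_exp (2 : ℝ)
    rw [Real.exp_neg, ← div_eq_mul_inv, div_le_one (Real.exp_pos _)]
    linarith
  calc (2 : ℝ) ^ d * (3 * Real.exp (-(2 * (d + Real.log (1 / δ)))))
      = ((2 : ℝ) ^ d * Real.exp (-2) ^ d) * (3 * δ ^ 2) := by rw [h1]; ring
    _ ≤ 1 * (3 * δ ^ 2) := by gcongr
    _ ≤ δ := by nlinarith

/-- The number of labeled examples that are used for empirical risk minimization. -/
noncomputable def ermSampleSize (α ε δ : ℝ) (d : ℕ) : ℕ :=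
  ⌈320 * (ε + α) / α ^ 2 * (2 * (d + Real.log (1 / δ)))⌉₊

lemma sampleSize_bounds {α ε δ n : ℝ} {b d : ℕ} (hα : 0 < α) (hα1 : α ≤ 1) (hε : 0 ≤ ε)
    (hδ : 0 < δ) (hδ' : δ ≤ 1 / 3) (hn : 10000 * sampleSize α ε δ b d ≤ n) :
    0 < n ∧ (b : ℝ) ≤ α / 4 * n ∧ (ermSampleSize α ε δ d : ℝ) ≤ α / 4 * n ∧
      320 * (ε + α) / α ^ 2 * (2 * (d + Real.log (1 / δ))) ≤ n ∧ 0 < ermSampleSize α ε δ d := by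
  set Λ : ℝ := d + Real.log (1 / δ) with hΛ
  have hlog : 1 ≤ Real.log (1 / δ) := by
    rw [Real.le_log_iff_exp_le (by positivity), le_div_iff₀ hδ]
    nlinarith [Real.exp_one_lt_d9]
  have hd : (0 : ℝ) ≤ d := Nat.cast_nonneg d
  have hb : (0 : ℝ) ≤ b := Nat.cast_nonneg b
  have hΛ1 : 1 ≤ Λ := by linarith
  set M : ℝ := (ε + α) / α ^ 2 * Λ with hM
  -- Needed to absorb the `+ 1` from rounding up `n₁`; it rests on `log (1 / δ) ≥ 1`, which follows
  -- from `δ ≤ 1 / 3`.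
  have hM1 : 1 ≤ M := by
    have : 1 ≤ (ε + α) / α ^ 2 := by
      rw [le_div_iff₀ (by positivity)]; nlinarith
    nlinarith
  have hT : α * sampleSize α ε δ b d = b + M := by
    rw [sampleSize, ← hΛ, hM]; field_simp
  have hαn : 10000 * (b + M) ≤ α * n := by
    rw [← hT]; nlinarith
  have hn0 : 0 < n := by
    by_contra hc
    nlinarith
  have hX : 320 * (ε + α) / α ^ 2 * (2 * Λ) = 640 * M := by rw [hM]; ring
  have hceil : (ermSampleSize α ε δ d : ℝ) ≤ 640 * M + 1 := by
    rw [ermSampleSize, ← hΛ, hX]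
    exact (Nat.ceil_lt_add_one (by positivity)).le
  refine ⟨hn0, by linarith, by linarith, ?_, ?_⟩
  · rw [hX]; nlinarith
  · rw [ermSampleSize, ← hΛ, hX, Nat.ceil_pos]
    positivity

/-! ### The theorem. -/

theorem mainTheorem4 :
    ∃ (C : ℝ) (k : ℕ), 0 < C ∧
      ∀ (X : Type uX) (Y : Type uY) (E : Type uE) (W : Type uW) (Θ : Type uT)
        [MeasurableSpace X] [Finite Y] [MeasurableSpace Y] [DiscreteMeasurableSpace Y]
        [MeasurableSpace E] [MeasurableSpace W]
        (p : FeedbackProtocol X Y E W Θ) (Φ : Set (X → Bool)) (H : FeatureClass Y Φ)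
        (α ε δ : ℝ) (b d : ℕ),
        0 < α → α ≤ 1 → 0 ≤ ε → ε ≤ 1 → 0 < δ → δ < 1 →
        HasFeatureInfluence.{uZ, uX, uY, uE, uW, uT} p H α ε δ b d →
        ∃ π : DiscoveryProtocol Y E W Φ,
          WitnessesFeatureInfluence.{uZ, uX, uY, uE, uW, uT} p H α ε δ b d π ∧
          ∃ (n₁ : ℕ → ℕ) (A : ℕ → Learner X Y E W), ∀ n : ℕ,
            C * sampleSize α ε δ b d * Real.log (2 + sampleSize α ε δ b d) ^ k ≤ n →
            (A n).Obeys p ∧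
            (A n).DiscoversThenERM π H (n₁ n) ∧
            ∀ (Z : Type uZ) [MeasurableSpace Z] (env : Environment Z X Y E W),
              env.Consistent p ε →
              env.streamLaw {ω | ε + 2 * α < env.mistakeRate (A n) ω n} ≤
                ENNReal.ofReal (3 * δ) := by
  refine ⟨10000, 0, by norm_num, ?_⟩
  intro X Y E W Θ _ _ _ _ _ _ p Φ H α ε δ b d hα hα1 hε hε1 hδ hδ1 ⟨π, hπ⟩
  refine ⟨π, hπ, fun _ => ermSampleSize α ε δ d,
    fun _ => discoverThenERM p π H (ermSampleSize α ε δ d), fun n hn =>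
    ⟨discoverThenERM_obeys hπ.obeys, discoverThenERM_discoversThenERM p π H _, ?_⟩⟩
  intro Z _ env henv
  rw [pow_zero, mul_one] at hn
  -- For `δ > 1 / 3` the allowed failure probability `3 δ` exceeds one.
  rcases lt_or_ge (1 / 3) δ with hδ3 | hδ3
  · refine prob_le_one.trans ?_
    rw [← ENNReal.ofReal_one]
    exact ENNReal.ofReal_le_ofReal (by linarith)
  obtain ⟨hn0, hbn, hn₁n, hLn, hn₁⟩ := sampleSize_bounds hα hα1 hε hδ hδ3 hn
  set n₁ := ermSampleSize α ε δ d with hn₁_def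
  have hA := discoverThenERM_discoversThenERM p π H n₁
  set A := discoverThenERM p π H n₁
  have hcap := hπ.capacity Z env henv
  have hbad := env.streamLaw_exists_stopsAt_badSample_le hπ.measurable (N := 2 ^ d) hα hε
    (Nat.le_ceil _) hLn (hcap.mono fun ω h t F hF => (h t F hF).imp_right le_two_pow_of_logb_le)
  rw [← ermSampleSize, ← hn₁_def] at hbad
  have herr := hπ.error Z env henv
  have hnull := ae_iff.1 ((hπ.mistakes Z env henv).and hcap)
  -- Failure lies in the union of a bad returned class, a bad sample (probability at most `δ` each)
  -- and a null set.
  refine le_trans (measure_mono (t := ({ω | ∃ τ F,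
      π.StopsAt (env.transcript π.toLearner ω) τ F ∧
        ¬ classErr (H.cls F) env.dist ≤ ENNReal.ofReal (ε + α)} ∪
    {ω | ∃ t < n, ∃ F, π.StopsAt (env.transcript π.toLearner ω) t F ∧
        (H.cls F).Finite ∧ ∃ h ∈ H.cls F, env.BadSample α ε n₁ n t h ω}) ∪ _) ?_)
    ((measure_union_le _ _).trans
      ((add_le_add ((measure_union_le _ _).trans (add_le_add herr hbad)) hnull.le).trans ?_))
  · intro ω hω
    by_contra hc
    simp only [Set.mem_union, not_or] at hc
    obtain ⟨⟨hc1, hc2⟩, hc3⟩ := hc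
    obtain ⟨hmist, hcapω⟩ := not_not.1 hc3
    have hω : ε + 2 * α < env.mistakeRate A ω n := hω
    refine absurd hω (not_lt.2 ?_)
    rw [Environment.mistakeRate, div_le_iff₀ hn0]
    by_cases hrun : π.RunsUntil (env.transcript π.toLearner ω) n
    · have h1 : (env.mistakes A ω n : ℝ) ≤ b := by
        rw [env.mistakes_eq_of_runsUntil hA hrun]
        exact_mod_cast hmist n hrun
      nlinarith
    · obtain ⟨τ, hτ, F, hF⟩ := DiscoveryProtocol.exists_stopsAt_of_not_runsUntil π hrun
      have hfin := (hcapω τ F hF).1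
      have h1 := env.mistakes_le_of_not_badSample hA hn₁ (n := n) hF hfin
        (not_not.1 fun h => hc1 ⟨τ, F, hF, h⟩)
        (fun h hh hb => hc2 ⟨τ, hτ, F, hF, hfin, h, hh, hb⟩)
      have h2 : (env.mistakes π.toLearner ω τ : ℝ) ≤ b := by exact_mod_cast hmist τ hF.1
      linarith
  · rw [add_zero, ← ENNReal.ofReal_add hδ.le (by positivity)]
    exact ENNReal.ofReal_le_ofReal (by linarith [two_pow_mul_exp_le d hδ hδ3])
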